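/- Let $n\ge 1$ and let $(\mathbb B^{n+1},d)$ be the unit ball model of $(n+1)$-dimensional hyperbolic space, with boundary sphere $\mathbb S^n$. A Kleinian group is a discrete group of orientation preserving isometries of $(\mathbb B^{n+1},d)$. Its limit set $L(G)\subset\mathbb S^n$ is the set of accumulation points in $\mathbb S^n$ of an arbitrary orbit $Gx$, $x\in\mathbb B^{n+1}$, and $G$ is non-elementary if $L(G)$ has more than two points. The Myrberg limit set $L_M(G)$ is the set of all $\xi\in L(G)$ such that for any distinct $x,y\in L(G)$ and any geodesic ray $\beta$ towards $\xi$ there is a sequence $(g_k)$ in $G$ such that $g_k(\beta)$ converges (as a subset of the ball, in the Euclidean Hausdorff distance) to the geodesic line connecting $x$ and $y$. The horospheric limit set $L_h(G)$ is the set of all $\xi\in L(G)$ such that for every $x\in\mathbb B^{n+1}$ every horoball tangent to $\mathbb S^n$ at $\xi$ contains a point of the orbit $Gx$. **Theorem.** Let $G$ be a non-elementary Kleinian group acting on $\mathbb B^{n+1}$ and let $N$ be a non-trivial normal subgroup of $G$; if $n\ge 3$, assume moreover that $N$ is infinite (which is automatic if $G$ is torsion free). Then $$L_M(G)\subset L_h(N).$$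 -/

import Mathlib

open Set Filter Topology

namespace Kleinian

noncomputable section

/-- The Euclidean space `ℝ^{n+1}` containing the unit ball and its boundary sphere `S^n`. -/
abbrev E (n : ℕ) : Type := EuclideanSpace ℝ (Fin (n + 1))

/-- The open unit ball `B^{n+1}`, with its Euclidean topology (which is also the topology of the
hyperbolic distance `hypDist` below). -/
abbrev HypBall (n : ℕ) : Type := Metric.ball (0 : E n) 1

/-- The hyperbolic distance of the unit ball model (curvature `-1`):
`cosh d(x, y) = 1 + 2 |x - y|² / ((1 - |x|²) (1 - |y|²))`. -/
def hypDist {n : ℕ} (x y : HypBall n) : ℝ :=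
  Real.arcosh (1 + 2 * ‖(x : E n) - (y : E n)‖ ^ 2 /
    ((1 - ‖(x : E n)‖ ^ 2) * (1 - ‖(y : E n)‖ ^ 2)))

/-- The group of all isometries of hyperbolic space `(B^{n+1}, d)`, under composition. -/
def isomGroup (n : ℕ) : Subgroup (Equiv.Perm (HypBall n)) where
  carrier := {g | ∀ x y, hypDist (g x) (g y) = hypDist x y}
  one_mem' := fun _ _ => rfl
  mul_mem' := fun {a b} ha hb x y => (ha (b x) (b y)).trans (hb x y)
  inv_mem' := fun {a} ha x y => by
    have h := ha (a⁻¹ x) (a⁻¹ y)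
    simp only [← Equiv.Perm.mul_apply, mul_inv_cancel, Equiv.Perm.one_apply] at h
    exact h.symm

/-- The isometry group carries the topology of pointwise convergence, which for groups of
isometries is the compact-open topology. -/
instance (n : ℕ) : TopologicalSpace (isomGroup n) :=
  TopologicalSpace.induced (fun (g : isomGroup n) (x : HypBall n) => g.1 x) Pi.topologicalSpace

open Classical in
/-- A self-map of the ball viewed as a map of `ℝ^{n+1}` (the values outside the open ball play no
role). -/
def extendMap {n : ℕ} (g : isomGroup n) (x : E n) : E n :=
  if h : x ∈ Metric.ball (0 : E n) 1 then (g.1 ⟨x, h⟩ : E n) else x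

/-- An isometry preserves orientation if its Jacobian determinant is positive on the ball. -/
def IsOrientationPreserving {n : ℕ} (g : isomGroup n) : Prop :=
  ∀ x ∈ Metric.ball (0 : E n) 1, 0 < (fderiv ℝ (extendMap g) x).det

/-- A Kleinian group: a discrete group of orientation preserving isometries of hyperbolic space. -/
structure IsKleinian {n : ℕ} (G : Subgroup (isomGroup n)) : Prop where
  orientationPreserving : ∀ g ∈ G, IsOrientationPreserving g
  discrete : DiscreteTopology G

/-- The orbit `G x`, as a subset of `ℝ^{n+1}`. -/
def orbitSet {n : ℕ} (G : Subgroup (isomGroup n)) (x : HypBall n) : Set (E n) :=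
  {y | ∃ g ∈ G, y = (g.1 x : E n)}

/-- The limit set `L(G)`: the points of `S^n` which are accumulation points of an arbitrary
`G`-orbit. -/
def limitSet {n : ℕ} (G : Subgroup (isomGroup n)) : Set (E n) :=
  {ξ | ξ ∈ Metric.sphere (0 : E n) 1 ∧ ∀ x : HypBall n, AccPt ξ (𝓟 (orbitSet G x))}

/-- `G` is non-elementary: its limit set has more than two points. -/
def IsNonElementary {n : ℕ} (G : Subgroup (isomGroup n)) : Prop :=
  2 < (limitSet G).encard

/-- `β` is a (unit speed) hyperbolic geodesic ray towards the boundary point `ξ`. -/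
def IsGeodesicRay {n : ℕ} (β : NNReal → HypBall n) (ξ : E n) : Prop :=
  (∀ s t, hypDist (β s) (β t) = dist s t) ∧ Tendsto (fun t => (β t : E n)) atTop (𝓝 ξ)

/-- `σ` is a (unit speed) hyperbolic geodesic line connecting the boundary points `x` and `y`. -/
def IsGeodesicLine {n : ℕ} (σ : ℝ → HypBall n) (x y : E n) : Prop :=
  (∀ s t, hypDist (σ s) (σ t) = dist s t) ∧
    Tendsto (fun t => (σ t : E n)) atBot (𝓝 x) ∧ Tendsto (fun t => (σ t : E n)) atTop (𝓝 y)

/-- The Myrberg limit set `L_M(G)`: the limit points `ξ` such that for all distinct limit points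
`x, y` and every geodesic ray `β` towards `ξ`, some sequence of translates `g_k(β)`, `g_k ∈ G`,
converges to the geodesic line connecting `x` and `y`. Convergence is that of subsets of the ball,
in the Euclidean Hausdorff distance, so neither the ray nor the line is oriented. -/
def myrbergLimitSet {n : ℕ} (G : Subgroup (isomGroup n)) : Set (E n) :=
  {ξ | ξ ∈ limitSet G ∧
    ∀ x ∈ limitSet G, ∀ y ∈ limitSet G, x ≠ y →
      ∀ β : NNReal → HypBall n, IsGeodesicRay β ξ →
        ∀ σ : ℝ → HypBall n, IsGeodesicLine σ x y →
          ∃ g : ℕ → isomGroup n, (∀ k, g k ∈ G) ∧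
            Tendsto (fun k => Metric.hausdorffEDist
              (range fun t => ((g k).1 (β t) : E n)) (range fun t => (σ t : E n)))
              atTop (𝓝 0)}

/-- The open horoball bounded by the horosphere tangent to `S^n` at `ξ` of Euclidean radius `r`
(where `|ξ| = 1` and `0 < r < 1`). -/
def horoball {n : ℕ} (ξ : E n) (r : ℝ) : Set (E n) :=
  Metric.ball ((1 - r) • ξ) r

/-- The horospheric limit set `L_h(G)`: the limit points `ξ` such that for every `x` in the ball,
every horoball at `ξ` contains a point of the orbit `G x`. -/
def horosphericLimitSet {n : ℕ} (G : Subgroup (isomGroup n)) : Set (E n) :=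
  {ξ | ξ ∈ limitSet G ∧
    ∀ x : HypBall n, ∀ r : ℝ, 0 < r → r < 1 → (horoball ξ r ∩ orbitSet G x).Nonempty}

end

end Kleinian

namespace Kleinian

noncomputable section

variable {n : ℕ}

/-! Write `b_ξ` for `expBusemann ξ`; small values mean deep inside horoballs at `ξ`. Suppose `f ∈ N`
moves a limit point `x` to `y ≠ x`. Since `ξ` is a Myrberg point, some `g ∈ G` carries the radial
ray to `ξ` close to the line from `x` to `y`, so `g ξ` is near `x` or near `y`. If it is near `y`, a
point of the image ray near `x` is thrown by `f` towards `y`, which shrinks the Busemann function at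
`g ξ` by any prescribed factor; if it is near `x`, use `f⁻¹` instead
(`exists_expBusemann_map_ray_le`). By normality the conjugate `h` by `g` lies in `N`, and the
cocycle property turns this into `b_ξ (h q) ≤ ε b_ξ q` at a ray point `q` at distance `t` from the
start of the ray. Here `b_ξ q = exp (-t)`, and returning from `h q` to the image of the start costs
at most a multiple of `cosh t`, so the two effects cancel (`exists_expBusemann_map_lt`).

Such an `f` exists (`exists_bdMap_ne`): otherwise `N` fixes three limit points. Discreteness then
makes `N` finite, which settles `n ≥ 3`. For `n ≤ 2`, a nontrivial isometry fixing three boundary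
points is a reflection, hence reverses orientation, so `N` is trivial. -/

/-! ### Conformal distortion and extension of isometries to the sphere. -/

lemma one_sub_norm_sq_pos (p : HypBall n) : 0 < 1 - ‖(p : E n)‖ ^ 2 := by
  have h := p.2
  rw [mem_ball_zero_iff] at h
  nlinarith [norm_nonneg (p : E n)]

lemma norm_lt_one (p : HypBall n) : ‖(p : E n)‖ < 1 := by
  exact mem_ball_zero_iff.1 p.2

/-- The origin of the ball. -/
def origin (n : ℕ) : HypBall n := ⟨0, by simp⟩

@[simp] lemma coe_origin : (origin n : E n) = 0 := rfl

/-- The hyperbolic cosine of the hyperbolic distance. -/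
def coshDist (x y : HypBall n) : ℝ :=
  1 + 2 * ‖(x : E n) - (y : E n)‖ ^ 2 / ((1 - ‖(x : E n)‖ ^ 2) * (1 - ‖(y : E n)‖ ^ 2))

lemma one_le_coshDist (x y : HypBall n) : 1 ≤ coshDist x y := by
  have hx := one_sub_norm_sq_pos x
  have hy := one_sub_norm_sq_pos y
  unfold coshDist
  have : 0 ≤ 2 * ‖(x : E n) - (y : E n)‖ ^ 2 /
    ((1 - ‖(x : E n)‖ ^ 2) * (1 - ‖(y : E n)‖ ^ 2)) := by positivity
  linarith

lemma coshDist_map (g : isomGroup n) (x y : HypBall n) :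
    coshDist (g.1 x) (g.1 y) = coshDist x y :=
  Real.arcosh_injOn (one_le_coshDist _ _) (one_le_coshDist _ _) (g.2 x y)

/-- Isometries are conformal, in integrated form. -/
lemma norm_sq_map_sub (g : isomGroup n) (x y : HypBall n) :
    ‖(g.1 x : E n) - g.1 y‖ ^ 2 * ((1 - ‖(x : E n)‖ ^ 2) * (1 - ‖(y : E n)‖ ^ 2)) =
      ‖(x : E n) - y‖ ^ 2 * ((1 - ‖(g.1 x : E n)‖ ^ 2) * (1 - ‖(g.1 y : E n)‖ ^ 2)) := by
  have h := coshDist_map g x y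
  have h1 := one_sub_norm_sq_pos x
  have h2 := one_sub_norm_sq_pos y
  have h3 := one_sub_norm_sq_pos (g.1 x)
  have h4 := one_sub_norm_sq_pos (g.1 y)
  unfold coshDist at h
  rw [add_right_inj, div_eq_div_iff (by positivity) (by positivity)] at h
  linarith

lemma norm_sub_le_two (x y : HypBall n) : ‖(x : E n) - y‖ ≤ 2 :=
  (norm_sub_le _ _).trans (by linarith [norm_lt_one x, norm_lt_one y])

/-- An isometry distorts the Euclidean distance to the boundary by a bounded factor. -/
lemma exists_one_sub_norm_sq_le (g : isomGroup n) :
    ∃ K : ℝ, 0 < K ∧ ∀ p : HypBall n,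
      1 - ‖(p : E n)‖ ^ 2 ≤ K * (1 - ‖(g.1 p : E n)‖ ^ 2) := by
  set c : HypBall n := (g⁻¹).1 (origin n) with hc
  have hgc : g.1 c = origin n := by simp [hc]
  have h1 := one_sub_norm_sq_pos c
  -- 5 = 1 + 4: split the product of the gaps of `c` and `p` with the weights `1 - |g p|²` and `|g
  -- p|²`; the second piece equals `|c - p|² (1 - |g p|²)` by conformality.
  refine ⟨5 / (1 - ‖(c : E n)‖ ^ 2), by positivity, fun p => ?_⟩
  have h2 := one_sub_norm_sq_pos p
  have h3 := one_sub_norm_sq_pos (g.1 p)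
  have key := norm_sq_map_sub g c p
  rw [hgc] at key
  simp only [coe_origin, zero_sub, norm_neg, norm_zero, ne_eq, OfNat.ofNat_ne_zero,
    not_false_eq_true, zero_pow, sub_zero, one_mul] at key
  have h4 : ‖(c : E n) - p‖ ^ 2 ≤ 4 := by
    nlinarith [norm_sub_le_two c p, norm_nonneg ((c : E n) - p)]
  rw [div_mul_eq_mul_div, le_div_iff₀ h1]
  have h5 : (1 - ‖(c : E n)‖ ^ 2) * (1 - ‖(p : E n)‖ ^ 2) ≤ 1 :=
    mul_le_one₀ (by nlinarith [sq_nonneg ‖(c : E n)‖]) h2.le (by nlinarith [sq_nonneg ‖(p : E n)‖])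
  nlinarith [mul_le_mul_of_nonneg_right h4 h3.le, mul_le_mul_of_nonneg_right h5 h3.le]

lemma exists_one_sub_norm_sq_map_le (g : isomGroup n) :
    ∃ K : ℝ, 0 < K ∧ ∀ p : HypBall n,
      1 - ‖(g.1 p : E n)‖ ^ 2 ≤ K * (1 - ‖(p : E n)‖ ^ 2) := by
  obtain ⟨K, hK, h⟩ := exists_one_sub_norm_sq_le g⁻¹
  exact ⟨K, hK, fun p => by simpa using h (g.1 p)⟩

/-- Isometries are Lipschitz for the Euclidean metric, so they extend continuously to the closed
ball. -/
lemma exists_continuous_extension (g : isomGroup n) :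
    ∃ F : E n → E n, Continuous F ∧ ∀ p : HypBall n, F p = g.1 p := by
  obtain ⟨K, hK, h⟩ := exists_one_sub_norm_sq_map_le g
  have hL : LipschitzOnWith ⟨K, hK.le⟩ (extendMap g) (Metric.ball (0 : E n) 1) := by
    refine LipschitzOnWith.of_dist_le_mul fun x hx y hy => ?_
    have ex : extendMap g x = g.1 ⟨x, hx⟩ := dif_pos hx
    have ey : extendMap g y = g.1 ⟨y, hy⟩ := dif_pos hy
    rw [ex, ey, dist_eq_norm, dist_eq_norm]
    -- The squared stretch is the product of the two boundary-gap ratios, each at most `K`.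
    have key := norm_sq_map_sub g ⟨x, hx⟩ ⟨y, hy⟩
    have h1 := one_sub_norm_sq_pos ⟨x, hx⟩
    have h2 := one_sub_norm_sq_pos ⟨y, hy⟩
    have h3 := one_sub_norm_sq_pos (g.1 ⟨x, hx⟩)
    have h4 := one_sub_norm_sq_pos (g.1 ⟨y, hy⟩)
    have h5 := h ⟨x, hx⟩
    have h6 := h ⟨y, hy⟩
    dsimp only at key h1 h2 h3 h4 h5 h6 ⊢
    refine le_of_sq_le_sq ?_ (by positivity)
    have h7 := mul_le_mul h5 h6 h4.le (by positivity)
    have h8 := mul_le_mul_of_nonneg_left h7 (sq_nonneg ‖x - y‖)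
    refine le_of_mul_le_mul_right ?_ (mul_pos h1 h2)
    rw [key]
    refine h8.trans_eq ?_
    change _ = (K * ‖x - y‖) ^ 2 * _
    ring
  obtain ⟨F, hF, hEq⟩ := hL.extend_finite_dimension
  refine ⟨F, hF.continuous, fun p => ?_⟩
  rw [← hEq p.2]
  exact dif_pos p.2

/-- A continuous extension of an isometry to the closed ball. -/
def bdMap (g : isomGroup n) : E n → E n := (exists_continuous_extension g).choose

lemma continuous_bdMap (g : isomGroup n) : Continuous (bdMap g) :=
  (exists_continuous_extension g).choose_spec.1

@[simp] lemma bdMap_coe (g : isomGroup n) (p : HypBall n) : bdMap g p = g.1 p :=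
  (exists_continuous_extension g).choose_spec.2 p

/-- An equation between continuous functions on the closed ball may be checked in the ball. -/
lemma eq_of_forall_ball_eq {X : Type*} [TopologicalSpace X] [T2Space X] {φ ψ : E n → X}
    (hφ : Continuous φ) (hψ : Continuous ψ) (h : ∀ p : HypBall n, φ p = ψ p)
    {ξ : E n} (hξ : ‖ξ‖ ≤ 1) : φ ξ = ψ ξ := by
  have hmem : ξ ∈ closure (Metric.ball (0 : E n) 1) := by
    rw [closure_ball _ one_ne_zero]; simpa using hξ
  exact closure_minimal (fun p hp => h ⟨p, hp⟩) (isClosed_eq hφ hψ) hmem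

lemma le_of_forall_ball_le {φ ψ : E n → ℝ}
    (hφ : Continuous φ) (hψ : Continuous ψ) (h : ∀ p : HypBall n, φ p ≤ ψ p)
    {ξ : E n} (hξ : ‖ξ‖ ≤ 1) : φ ξ ≤ ψ ξ := by
  have hmem : ξ ∈ closure (Metric.ball (0 : E n) 1) := by
    rw [closure_ball _ one_ne_zero]; simpa using hξ
  exact closure_minimal (fun p hp => h ⟨p, hp⟩) (isClosed_le hφ hψ) hmem

lemma norm_bdMap (g : isomGroup n) {ξ : E n} (hξ : ‖ξ‖ = 1) : ‖bdMap g ξ‖ = 1 := by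
  have hc := continuous_bdMap g
  obtain ⟨K, hK, h⟩ := exists_one_sub_norm_sq_map_le g
  have h1 : 1 - ‖bdMap g ξ‖ ^ 2 ≤ K * (1 - ‖ξ‖ ^ 2) :=
    le_of_forall_ball_le (φ := fun p => 1 - ‖bdMap g p‖ ^ 2)
      (ψ := fun p => K * (1 - ‖p‖ ^ 2)) (by fun_prop) (by fun_prop) (by simpa using h) hξ.le
  have h2 : ‖bdMap g ξ‖ ≤ 1 :=
    le_of_forall_ball_le (φ := fun p => ‖bdMap g p‖) (ψ := fun _ => 1) (by fun_prop)
      (by fun_prop) (fun p => by simpa using (norm_lt_one (g.1 p)).le) hξ.le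
  rw [hξ] at h1
  nlinarith [norm_nonneg (bdMap g ξ)]

lemma bdMap_inv_bdMap (g : isomGroup n) {ξ : E n} (hξ : ‖ξ‖ = 1) :
    bdMap g⁻¹ (bdMap g ξ) = ξ :=
  eq_of_forall_ball_eq (φ := fun p => bdMap g⁻¹ (bdMap g p)) (ψ := fun p => p)
    ((continuous_bdMap _).comp (continuous_bdMap _)) continuous_id (by simp) hξ.le

/-! ### Busemann functions and conformal factors on the sphere. -/

/-- The exponential of the Busemann function centred at `ξ`, normalised at the origin. -/
def expBusemann (ξ : E n) (p : HypBall n) : ℝ := ‖ξ - p‖ ^ 2 / (1 - ‖(p : E n)‖ ^ 2)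

lemma ne_coe_of_norm_eq_one {ξ : E n} (hξ : ‖ξ‖ = 1) (p : HypBall n) : ξ ≠ p := by
  rintro rfl
  exact (norm_lt_one p).ne hξ

lemma expBusemann_pos {ξ : E n} (hξ : ‖ξ‖ = 1) (p : HypBall n) : 0 < expBusemann ξ p := by
  have h1 := one_sub_norm_sq_pos p
  have h2 : 0 < ‖ξ - p‖ := norm_pos_iff.2 (sub_ne_zero.2 (ne_coe_of_norm_eq_one hξ p))
  unfold expBusemann
  positivity

/-- The cocycle property of the Busemann functions. -/
lemma expBusemann_bdMap (g : isomGroup n) {ξ : E n} (hξ : ‖ξ‖ = 1) (p : HypBall n) :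
    expBusemann (bdMap g ξ) (g.1 p) =
      expBusemann (bdMap g ξ) (g.1 (origin n)) * expBusemann ξ p := by
  have hc := continuous_bdMap g
  have h1 := one_sub_norm_sq_pos p
  have h2 := one_sub_norm_sq_pos (g.1 p)
  have h3 := one_sub_norm_sq_pos (g.1 (origin n))
  -- Comparing the pairs `(q, p)` and `(q, origin)` eliminates the gap of `g q`, leaving an identity
  -- that extends to the sphere; the factor `‖ξ‖ ^ 2` is the distance to the origin.
  have key : ‖bdMap g ξ - g.1 p‖ ^ 2 * ((1 - ‖(p : E n)‖ ^ 2) *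
        (1 - ‖(g.1 (origin n) : E n)‖ ^ 2) * ‖ξ‖ ^ 2) =
      ‖bdMap g ξ - g.1 (origin n)‖ ^ 2 * ‖ξ - p‖ ^ 2 * (1 - ‖(g.1 p : E n)‖ ^ 2) := by
    refine eq_of_forall_ball_eq (φ := fun η => ‖bdMap g η - g.1 p‖ ^ 2 * ((1 - ‖(p : E n)‖ ^ 2) *
        (1 - ‖(g.1 (origin n) : E n)‖ ^ 2) * ‖η‖ ^ 2))
      (ψ := fun η => ‖bdMap g η - g.1 (origin n)‖ ^ 2 * ‖η - p‖ ^ 2 *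
        (1 - ‖(g.1 p : E n)‖ ^ 2)) (by fun_prop) (by fun_prop) (fun q => ?_) hξ.le
    simp only [bdMap_coe]
    have e1 := norm_sq_map_sub g q p
    have e2 := norm_sq_map_sub g q (origin n)
    simp only [coe_origin, norm_zero, sub_zero, ne_eq, OfNat.ofNat_ne_zero,
      not_false_eq_true, zero_pow, mul_one] at e2
    have h4 := one_sub_norm_sq_pos q
    refine mul_right_cancel₀ (mul_pos h4 (one_sub_norm_sq_pos (g.1 q))).ne' ?_
    linear_combination (1 - ‖(g.1 (origin n) : E n)‖ ^ 2) * ‖(q : E n)‖ ^ 2 *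
      (1 - ‖(g.1 q : E n)‖ ^ 2) * e1 - ‖(q : E n) - p‖ ^ 2 * (1 - ‖(g.1 q : E n)‖ ^ 2) *
        (1 - ‖(g.1 p : E n)‖ ^ 2) * e2
  unfold expBusemann
  rw [hξ] at key
  field_simp
  linear_combination key

/-- Obtained by sending the interior point of the cocycle identity to `η`. The two factors act as
conformal derivatives of `g` at `ξ` and `η`, so at a pair of fixed points their product is 1. -/
lemma norm_sq_bdMap_sub (g : isomGroup n) {ξ η : E n} (hξ : ‖ξ‖ = 1) (hη : ‖η‖ = 1) :
    ‖bdMap g ξ - bdMap g η‖ ^ 2 =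
      expBusemann (bdMap g ξ) (g.1 (origin n)) * expBusemann (bdMap g η) (g.1 (origin n)) *
        ‖ξ - η‖ ^ 2 := by
  have hc := continuous_bdMap g
  have h3 := one_sub_norm_sq_pos (g.1 (origin n))
  have key : ‖bdMap g ξ - bdMap g η‖ ^ 2 * ((1 - ‖(g.1 (origin n) : E n)‖ ^ 2) * ‖η‖ ^ 2) =
      expBusemann (bdMap g ξ) (g.1 (origin n)) * ‖bdMap g η - g.1 (origin n)‖ ^ 2 *
        ‖ξ - η‖ ^ 2 := by
    refine eq_of_forall_ball_eq (φ := fun η => ‖bdMap g ξ - bdMap g η‖ ^ 2 *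
        ((1 - ‖(g.1 (origin n) : E n)‖ ^ 2) * ‖η‖ ^ 2))
      (ψ := fun η => expBusemann (bdMap g ξ) (g.1 (origin n)) *
        ‖bdMap g η - g.1 (origin n)‖ ^ 2 * ‖ξ - η‖ ^ 2)
      (by fun_prop) (by fun_prop) (fun q => ?_) hη.le
    simp only [bdMap_coe]
    have e1 := expBusemann_bdMap g hξ q
    have e2 := norm_sq_map_sub g q (origin n)
    simp only [coe_origin, norm_zero, sub_zero, ne_eq, OfNat.ofNat_ne_zero,
      not_false_eq_true, zero_pow, mul_one] at e2
    have h4 := one_sub_norm_sq_pos q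
    have h5 := one_sub_norm_sq_pos (g.1 q)
    set lam := expBusemann (bdMap g ξ) (g.1 (origin n))
    unfold expBusemann at e1
    rw [div_eq_iff h5.ne', mul_assoc, div_mul_eq_mul_div, mul_div_assoc', eq_div_iff h4.ne'] at e1
    refine mul_right_cancel₀ h4.ne' ?_
    linear_combination (1 - ‖(g.1 (origin n) : E n)‖ ^ 2) * ‖(q : E n)‖ ^ 2 * e1 -
      lam * ‖ξ - q‖ ^ 2 * e2
  rw [hη] at key
  set lam := expBusemann (bdMap g ξ) (g.1 (origin n))
  unfold expBusemann
  field_simp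
  linear_combination key

lemma bdMap_mem_limitSet {G : Subgroup (isomGroup n)} {g : isomGroup n} (hg : g ∈ G) {ξ : E n}
    (hξ : ξ ∈ limitSet G) : bdMap g ξ ∈ limitSet G := by
  have hn : ‖ξ‖ = 1 := by simpa using hξ.1
  have hn' := norm_bdMap g hn
  refine ⟨by simpa using hn', fun x => ?_⟩
  have h := hξ.2 x
  rw [accPt_iff_nhds] at h ⊢
  intro U hU
  obtain ⟨y, ⟨hyU, f, hf, rfl⟩, -⟩ := h _ ((continuous_bdMap g).continuousAt.preimage_mem_nhds hU)
  refine ⟨g.1 (f.1 x), ⟨?_, g * f, G.mul_mem hg hf, rfl⟩, (ne_coe_of_norm_eq_one hn' _).symm⟩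
  simpa using hyU

/-! ### Explicit geodesic lines and rays. -/

/-- The hyperbolic geodesic line from `x` to `y`, as a map to `ℝ^{n+1}`. -/
def lineMap (x y : E n) (t : ℝ) : E n :=
  (‖x - y‖ + Real.exp t + Real.exp (-t))⁻¹ • (Real.exp (-t) • x + Real.exp t • y)

lemma lineMap_neg (x y : E n) (t : ℝ) : lineMap x y (-t) = lineMap y x t := by
  unfold lineMap
  rw [norm_sub_rev x y, neg_neg, add_comm (Real.exp t • x), add_right_comm]

lemma inner_eq_one_sub {x y : E n} (hx : ‖x‖ = 1) (hy : ‖y‖ = 1) :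
    inner ℝ x y = 1 - ‖x - y‖ ^ 2 / 2 := by
  have h := norm_sub_sq_real x y
  rw [hx, hy] at h
  linarith

lemma lineMap_denom_pos (x y : E n) (t : ℝ) : 0 < ‖x - y‖ + Real.exp t + Real.exp (-t) := by
  positivity

lemma inner_lineMap {x y : E n} (hx : ‖x‖ = 1) (hy : ‖y‖ = 1) (s t : ℝ) :
    inner ℝ (lineMap x y s) (lineMap x y t) =
      (‖x - y‖ + Real.exp s + Real.exp (-s))⁻¹ * ((‖x - y‖ + Real.exp t + Real.exp (-t))⁻¹ *
        ((Real.exp s + Real.exp (-s)) * (Real.exp t + Real.exp (-t)) -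
          (Real.exp s * Real.exp (-t) + Real.exp (-s) * Real.exp t) * (‖x - y‖ ^ 2 / 2))) := by
  unfold lineMap
  simp only [inner_smul_left, inner_smul_right, inner_add_left, inner_add_right,
    real_inner_self_eq_norm_sq, hx, hy, inner_eq_one_sub hx hy, inner_eq_one_sub hy hx,
    norm_sub_rev y x, RCLike.conj_to_real]
  ring

lemma one_sub_norm_sq_lineMap {x y : E n} (hx : ‖x‖ = 1) (hy : ‖y‖ = 1) (t : ℝ) :
    1 - ‖lineMap x y t‖ ^ 2 = 2 * ‖x - y‖ / (‖x - y‖ + Real.exp t + Real.exp (-t)) := by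
  have h := lineMap_denom_pos x y t
  have e : Real.exp t * Real.exp (-t) = 1 := by rw [← Real.exp_add]; simp
  rw [← real_inner_self_eq_norm_sq, inner_lineMap hx hy]
  field_simp
  linear_combination (2 * ‖x - y‖ ^ 2) * e

/-- The hyperbolic geodesic line between two distinct boundary points. -/
def line (x y : E n) (hx : ‖x‖ = 1) (hy : ‖y‖ = 1) (hxy : x ≠ y) (t : ℝ) : HypBall n :=
  ⟨lineMap x y t, by
    have h := one_sub_norm_sq_lineMap hx hy t
    have h1 := lineMap_denom_pos x y t
    have h2 : 0 < ‖x - y‖ := norm_pos_iff.2 (sub_ne_zero.2 hxy)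
    have h3 : 0 < 1 - ‖lineMap x y t‖ ^ 2 := by rw [h]; positivity
    rw [mem_ball_zero_iff]
    nlinarith [norm_nonneg (lineMap x y t)]⟩

/-- `lineMap` is the projection `V / (1 + T)` to the ball of the hyperboloid curve `(T, V) = (exp
(-t) (1, x) + exp t (1, y)) / ‖x - y‖`, a unit speed geodesic between null directions. -/
lemma coshDist_line {x y : E n} (hx : ‖x‖ = 1) (hy : ‖y‖ = 1) (hxy : x ≠ y) (s t : ℝ) :
    coshDist (line x y hx hy hxy s) (line x y hx hy hxy t) = Real.cosh (s - t) := by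
  have h2 : 0 < ‖x - y‖ := norm_pos_iff.2 (sub_ne_zero.2 hxy)
  have hs := lineMap_denom_pos x y s
  have ht := lineMap_denom_pos x y t
  have es : Real.exp s * Real.exp (-s) = 1 := by rw [← Real.exp_add]; simp
  have et : Real.exp t * Real.exp (-t) = 1 := by rw [← Real.exp_add]; simp
  unfold coshDist line
  rw [norm_sub_sq_real, one_sub_norm_sq_lineMap hx hy, one_sub_norm_sq_lineMap hx hy,
    inner_lineMap hx hy, ← sub_sub_cancel 1 (‖lineMap x y s‖ ^ 2),
    ← sub_sub_cancel 1 (‖lineMap x y t‖ ^ 2),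
    one_sub_norm_sq_lineMap hx hy, one_sub_norm_sq_lineMap hx hy, Real.cosh_eq, neg_sub,
    sub_eq_add_neg s t, sub_eq_add_neg t s, Real.exp_add, Real.exp_add]
  field_simp
  ring

lemma hypDist_line {x y : E n} (hx : ‖x‖ = 1) (hy : ‖y‖ = 1) (hxy : x ≠ y) (s t : ℝ) :
    hypDist (line x y hx hy hxy s) (line x y hx hy hxy t) = dist s t := by
  change Real.arcosh (coshDist _ _) = _
  rw [coshDist_line, ← Real.cosh_abs, Real.arcosh_cosh (abs_nonneg _), Real.dist_eq]

lemma tendsto_lineMap_atTop (x y : E n) : Tendsto (lineMap x y) atTop (𝓝 y) := by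
  have h0 : Tendsto (fun t : ℝ => Real.exp (-t)) atTop (𝓝 0) :=
    Real.tendsto_exp_atBot.comp tendsto_neg_atTop_atBot
  have hmul : ∀ t : ℝ, lineMap x y t =
      (‖x - y‖ * Real.exp (-t) + 1 + Real.exp (-t) ^ 2)⁻¹ • (Real.exp (-t) ^ 2 • x + y) := by
    intro t
    have e : Real.exp (-t) * Real.exp t = 1 := by rw [← Real.exp_add]; simp
    have hd : ‖x - y‖ * Real.exp (-t) + 1 + Real.exp (-t) ^ 2 =
        Real.exp (-t) * (‖x - y‖ + Real.exp t + Real.exp (-t)) := by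
      linear_combination -e
    have hv : Real.exp (-t) ^ 2 • x + y = Real.exp (-t) • (Real.exp (-t) • x + Real.exp t • y) := by
      rw [smul_add, smul_smul, smul_smul, e, one_smul, sq]
    rw [hd, hv, smul_smul, mul_inv, mul_right_comm, inv_mul_cancel₀ (Real.exp_pos _).ne', one_mul]
    rfl
  have hlim : Tendsto (fun t : ℝ => (‖x - y‖ * Real.exp (-t) + 1 + Real.exp (-t) ^ 2)⁻¹ •
      (Real.exp (-t) ^ 2 • x + y)) atTop
      (𝓝 ((‖x - y‖ * 0 + 1 + 0 ^ 2 : ℝ)⁻¹ • ((0 : ℝ) ^ 2 • x + y))) :=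
    ((((h0.const_mul _).add_const 1).add (h0.pow 2)).inv₀ (by simp)).smul
      (((h0.pow 2).smul_const x).add_const y)
  rw [show lineMap x y = _ from funext hmul]
  simpa using hlim

lemma tendsto_lineMap_atBot (x y : E n) : Tendsto (lineMap x y) atBot (𝓝 x) := by
  have h := (tendsto_lineMap_atTop y x).comp tendsto_neg_atBot_atTop
  refine h.congr fun t => ?_
  rw [Function.comp_apply, lineMap_neg]

lemma isGeodesicLine_line {x y : E n} (hx : ‖x‖ = 1) (hy : ‖y‖ = 1) (hxy : x ≠ y) :
    IsGeodesicLine (line x y hx hy hxy) x y :=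
  ⟨hypDist_line hx hy hxy, tendsto_lineMap_atBot x y, tendsto_lineMap_atTop x y⟩

lemma continuous_lineMap (x y : E n) : Continuous (lineMap x y) := by
  unfold lineMap
  refine Continuous.smul (Continuous.inv₀ (by fun_prop) fun t => (lineMap_denom_pos x y t).ne') ?_
  fun_prop

/-- A geodesic line accumulates on the sphere only at its two end points. -/
lemma eq_or_eq_of_mem_closure_line {x y : E n} (hx : ‖x‖ = 1) (hy : ‖y‖ = 1) (hxy : x ≠ y)
    {z : E n} (hz : ‖z‖ = 1) (h : z ∈ closure (range (lineMap x y))) : z = x ∨ z = y := by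
  by_contra! hne
  obtain ⟨U, hU, V, hV, hUV⟩ := (disjoint_nhds_nhds.2 hne.1).exists_mem_filter_basis
    (basis_sets _) (basis_sets _)
  obtain ⟨U', hU', V', hV', hUV'⟩ := (disjoint_nhds_nhds.2 hne.2).exists_mem_filter_basis
    (basis_sets _) (basis_sets _)
  obtain ⟨A, hA⟩ := eventually_atBot.1 ((tendsto_lineMap_atBot x y).eventually hV)
  obtain ⟨B, hB⟩ := eventually_atTop.1 ((tendsto_lineMap_atTop x y).eventually hV')
  have hK : IsClosed (lineMap x y '' Icc A B) :=
    (isCompact_Icc.image (continuous_lineMap x y)).isClosed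
  -- Away from `x` and `y` only a compact parameter interval matters, so `z` would lie on the line
  -- itself, inside the ball.
  have hmem : z ∈ closure (lineMap x y '' Icc A B) := by
    rw [mem_closure_iff_nhds] at h ⊢
    intro W hW
    obtain ⟨_, hw, t, rfl⟩ := h _ (inter_mem hW (inter_mem hU hU'))
    refine ⟨_, hw.1, t, ⟨?_, ?_⟩, rfl⟩
    · by_contra! ht
      exact disjoint_left.1 hUV hw.2.1 (hA t ht.le)
    · by_contra! ht
      exact disjoint_left.1 hUV' hw.2.2 (hB t ht.le)
  rw [hK.closure_eq] at hmem
  obtain ⟨t, -, rfl⟩ := hmem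
  exact (norm_lt_one (line x y hx hy hxy t)).ne hz

lemma expBusemann_line {x y : E n} (hx : ‖x‖ = 1) (hy : ‖y‖ = 1) (hxy : x ≠ y) (t : ℝ) :
    expBusemann y (line x y hx hy hxy t) = ‖x - y‖ / 2 * Real.exp (-t) := by
  have h2 : 0 < ‖x - y‖ := norm_pos_iff.2 (sub_ne_zero.2 hxy)
  have ht := lineMap_denom_pos x y t
  have hin : inner ℝ y (lineMap x y t) = (‖x - y‖ + Real.exp t + Real.exp (-t))⁻¹ *
      (Real.exp (-t) * (1 - ‖x - y‖ ^ 2 / 2) + Real.exp t) := by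
    unfold lineMap
    simp only [inner_smul_right, inner_add_right, real_inner_self_eq_norm_sq, hy,
      inner_eq_one_sub hy hx, norm_sub_rev y x]
    ring
  unfold expBusemann line
  rw [one_sub_norm_sq_lineMap hx hy, norm_sub_sq_real, hin, hy,
    ← sub_sub_cancel 1 (‖lineMap x y t‖ ^ 2), one_sub_norm_sq_lineMap hx hy]
  field_simp
  ring

lemma neg_ne_self_of_norm_eq_one {ξ : E n} (hξ : ‖ξ‖ = 1) : -ξ ≠ ξ := by
  intro h
  have h2 : (2 : ℝ) • ξ = 0 := by rw [two_smul, ← neg_eq_iff_add_eq_zero, h]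
  have h3 : ξ = 0 := by simpa using h2
  simp [h3] at hξ

/-- The radial geodesic ray from the origin. -/
def ray (ξ : E n) (hξ : ‖ξ‖ = 1) (t : NNReal) : HypBall n :=
  line (-ξ) ξ (by simpa using hξ) hξ (neg_ne_self_of_norm_eq_one hξ) t

lemma isGeodesicRay_ray {ξ : E n} (hξ : ‖ξ‖ = 1) : IsGeodesicRay (ray ξ hξ) ξ :=
  ⟨fun _ _ => hypDist_line _ _ _ _ _,
    (tendsto_lineMap_atTop (-ξ) ξ).comp (NNReal.tendsto_coe_atTop.2 tendsto_id)⟩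

/-- The product is `cosh t * exp (-t)`: the decay of the Busemann function along the ray exactly
pays for the Lipschitz loss over distance `t`. -/
lemma coshDist_ray_mul_expBusemann_le {ξ : E n} (hξ : ‖ξ‖ = 1) (t : NNReal) :
    coshDist (ray ξ hξ 0) (ray ξ hξ t) * expBusemann ξ (ray ξ hξ t) ≤ 1 := by
  unfold ray
  rw [coshDist_line, expBusemann_line, NNReal.coe_zero, zero_sub, Real.cosh_neg, Real.cosh_eq,
    show ‖-ξ - ξ‖ = 2 by rw [← neg_add', norm_neg, ← two_smul ℝ, norm_smul, hξ]; norm_num]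
  have e : Real.exp (t : ℝ) * Real.exp (-t) = 1 := by rw [← Real.exp_add]; simp
  have h1 : Real.exp (-(t : ℝ)) ≤ 1 := Real.exp_le_one_iff.2 (by simp)
  nlinarith [Real.exp_pos (-(t : ℝ))]

/-! ### Harnack-type bounds and the dynamics at a Myrberg point. -/

/-- With `a`, `b` the gaps of `p`, `q` and `D` their distance, `b ≤ a + 2D` gives `b² ≤ ab + 2Db`,
and `2Db ≤ b²/2 + 2D²`. The bound equals `2ab * coshDist p q`. -/
lemma sq_one_sub_norm_sq_le (p q : HypBall n) :
    (1 - ‖(q : E n)‖ ^ 2) ^ 2 ≤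
      2 * ((1 - ‖(p : E n)‖ ^ 2) * (1 - ‖(q : E n)‖ ^ 2)) + 4 * ‖(p : E n) - q‖ ^ 2 := by
  have hb := one_sub_norm_sq_pos q
  have hD : ‖(p : E n)‖ - ‖(q : E n)‖ ≤ ‖(p : E n) - q‖ := norm_sub_norm_le _ _
  have hba : 1 - ‖(q : E n)‖ ^ 2 ≤ 1 - ‖(p : E n)‖ ^ 2 + 2 * ‖(p : E n) - q‖ := by
    nlinarith [norm_nonneg (q : E n), norm_nonneg (p : E n), norm_nonneg ((p : E n) - q),
      norm_lt_one p, norm_lt_one q]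
  nlinarith [sq_nonneg (1 - ‖(q : E n)‖ ^ 2 - 2 * ‖(p : E n) - q‖)]

/-- Up to a constant factor, Busemann functions are `1`-Lipschitz. -/
lemma expBusemann_le {ξ : E n} (hξ : ‖ξ‖ = 1) (p q : HypBall n) :
    expBusemann ξ p ≤ 8 * coshDist p q * expBusemann ξ q := by
  have ha := one_sub_norm_sq_pos p
  have hb := one_sub_norm_sq_pos q
  have hq := norm_lt_one q
  have hXY : ‖ξ - p‖ ≤ ‖ξ - q‖ + ‖(p : E n) - q‖ := by
    rw [norm_sub_rev (p : E n)]
    exact norm_sub_le_norm_sub_add_norm_sub _ _ _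
  have hY : 1 - ‖(q : E n)‖ ≤ ‖ξ - q‖ := by
    have := norm_sub_norm_le ξ (q : E n)
    rwa [hξ] at this
  have hbY : 1 - ‖(q : E n)‖ ^ 2 ≤ 2 * ‖ξ - q‖ := by nlinarith [norm_nonneg (q : E n)]
  have hb2 := sq_one_sub_norm_sq_le p q
  unfold expBusemann coshDist
  set a := 1 - ‖(p : E n)‖ ^ 2
  set b := 1 - ‖(q : E n)‖ ^ 2
  set X := ‖ξ - p‖
  set Y := ‖ξ - q‖
  set D := ‖(p : E n) - q‖
  have hX0 : 0 ≤ X := norm_nonneg _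
  have hY0 : 0 ≤ Y := norm_nonneg _
  have hD0 : 0 ≤ D := norm_nonneg _
  have hX2 : X ^ 2 ≤ 2 * Y ^ 2 + 2 * D ^ 2 := by nlinarith [sq_nonneg (Y - D)]
  have hb4 : b ^ 2 ≤ 4 * Y ^ 2 := by nlinarith
  have main : X ^ 2 * b ^ 2 ≤ 8 * (a * b + 2 * D ^ 2) * Y ^ 2 := by
    have hab := mul_pos ha hb
    nlinarith [mul_le_mul_of_nonneg_right hX2 (sq_nonneg b),
      mul_le_mul_of_nonneg_left hb2 (sq_nonneg Y), mul_le_mul_of_nonneg_left hb4 (sq_nonneg D),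
      mul_nonneg hab.le (sq_nonneg Y)]
  have e : 8 * (1 + 2 * D ^ 2 / (a * b)) * (Y ^ 2 / b) =
      (8 * (a * b + 2 * D ^ 2) * Y ^ 2 / b ^ 2) / a := by
    field_simp
  rw [e]
  gcongr
  rwa [le_div_iff₀ (by positivity)]

/-- If `f` moves `x` to `y ≠ x`, then `f` moves points near `x` deep into horoballs based near
`y`. -/
lemma exists_expBusemann_le_mul (f : isomGroup n) {x y : E n} (hxy : x ≠ y)
    (hf : bdMap f x = y) {ε : ℝ} (hε : 0 < ε) :
    ∃ δ > 0, ∀ ζ : E n, dist ζ y < δ → ∀ q : HypBall n, dist (q : E n) x < δ →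
      expBusemann ζ (f.1 q) ≤ ε * expBusemann ζ q := by
  obtain ⟨K, hK, h⟩ := exists_one_sub_norm_sq_le f
  have hc := continuous_bdMap f
  -- Negativity of this function at `(y, x)` persists nearby; the bound `K` on the gap ratio
  -- converts it into the claim.
  have hcont : Continuous fun v : E n × E n =>
      K * ‖v.1 - bdMap f v.2‖ ^ 2 - ε * ‖v.1 - v.2‖ ^ 2 := by fun_prop
  have hneg : K * ‖y - bdMap f x‖ ^ 2 - ε * ‖y - x‖ ^ 2 < 0 := by
    have : 0 < ‖y - x‖ := norm_pos_iff.2 (sub_ne_zero.2 hxy.symm)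
    rw [hf, sub_self, norm_zero]
    have : 0 < ε * ‖y - x‖ ^ 2 := by positivity
    linarith
  have hev := hcont.continuousAt.eventually (isOpen_Iio.mem_nhds (show _ ∈ Iio (0 : ℝ) from hneg) :
    Iio (0 : ℝ) ∈ 𝓝 ((fun v : E n × E n =>
      K * ‖v.1 - bdMap f v.2‖ ^ 2 - ε * ‖v.1 - v.2‖ ^ 2) (y, x)))
  obtain ⟨δ, hδ, hball⟩ := Metric.eventually_nhds_iff.1 hev
  refine ⟨δ, hδ, fun ζ hζ q hq => ?_⟩
  have h1 := @hball (ζ, (q : E n)) (by simpa [Prod.dist_eq] using ⟨hζ, hq⟩)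
  simp only [bdMap_coe, sub_neg] at h1
  have h2 := one_sub_norm_sq_pos q
  have h3 := one_sub_norm_sq_pos (f.1 q)
  unfold expBusemann
  rw [mul_div_assoc', div_le_div_iff₀ h3 h2]
  nlinarith [mul_le_mul_of_nonneg_left (h q) (sq_nonneg ‖ζ - f.1 q‖),
    mul_le_mul_of_nonneg_right h1.le h3.le]

lemma coshDist_nonneg (x y : HypBall n) : 0 ≤ coshDist x y :=
  zero_le_one.trans (one_le_coshDist x y)

/-- The dynamical core: a Myrberg ray is carried close to a geodesic line from `x` to `f x`, and
there `f` or `f⁻¹` pushes a point of the ray towards its end. -/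
lemma exists_expBusemann_map_ray_le {G : Subgroup (isomGroup n)} {ξ : E n} (hξ : ‖ξ‖ = 1)
    (hM : ξ ∈ myrbergLimitSet G) {f : isomGroup n} (hf : f ∈ G) {x : E n} (hx : x ∈ limitSet G)
    (hfx : bdMap f x ≠ x) {ε : ℝ} (hε : 0 < ε) :
    ∃ g ∈ G, ∃ e : isomGroup n, (e = f ∨ e = f⁻¹) ∧ ∃ t : NNReal,
      expBusemann (bdMap g ξ) (e.1 (g.1 (ray ξ hξ t))) ≤
        ε * expBusemann (bdMap g ξ) (g.1 (ray ξ hξ t)) := by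
  have hx1 : ‖x‖ = 1 := by simpa using hx.1
  set y := bdMap f x with hy
  have hyL : y ∈ limitSet G := bdMap_mem_limitSet hf hx
  have hy1 : ‖y‖ = 1 := norm_bdMap f hx1
  obtain ⟨δ₁, hδ₁, h₁⟩ := exists_expBusemann_le_mul f hfx.symm rfl hε
  obtain ⟨δ₂, hδ₂, h₂⟩ := exists_expBusemann_le_mul f⁻¹ hfx (bdMap_inv_bdMap f hx1) hε
  set δ := min δ₁ δ₂ with hδ
  have hδ0 : 0 < δ := lt_min hδ₁ hδ₂
  set R := range (lineMap x y) with hR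
  have hKc : IsCompact (Metric.sphere (0 : E n) 1 \ (Metric.ball x δ ∪ Metric.ball y δ)) :=
    (isCompact_sphere _ _).diff (Metric.isOpen_ball.union Metric.isOpen_ball)
  -- The line meets the sphere at infinity only at `x` and `y`, so the rest of the sphere keeps a
  -- positive distance `r` from it.
  obtain ⟨r, hr, hsep⟩ := Metric.exists_pos_forall_lt_edist hKc (isClosed_closure (s := R)) (by
    refine disjoint_left.2 fun z hz hzR => hz.2 ?_
    rcases eq_or_eq_of_mem_closure_line hx1 hy1 hfx.symm (by simpa using hz.1) hzR with rfl | rfl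
    · exact Or.inl (Metric.mem_ball_self hδ0)
    · exact Or.inr (Metric.mem_ball_self hδ0))
  obtain ⟨g, hg, hlim⟩ := hM.2 x hx y hyL hfx.symm _ (isGeodesicRay_ray hξ) _
    (isGeodesicLine_line hx1 hy1 hfx.symm)
  obtain ⟨k, hk₁, hk₂⟩ := ((hlim.eventually_lt_const (show (0 : ENNReal) < r by exact_mod_cast hr)).and
    (hlim.eventually_lt_const (ENNReal.ofReal_pos.2 hδ0))).exists
  set S := range fun t => ((g k).1 (ray ξ hξ t) : E n) with hS
  change Metric.hausdorffEDist S R < _ at hk₁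
  change Metric.hausdorffEDist S R < _ at hk₂
  have hζ1 : ‖bdMap (g k) ξ‖ = 1 := norm_bdMap (g k) hξ
  have hζS : bdMap (g k) ξ ∈ closure S := by
    have ht := ((continuous_bdMap (g k)).tendsto ξ).comp (isGeodesicRay_ray hξ).2
    refine mem_closure_of_tendsto ht (Eventually.of_forall fun t => ⟨t, ?_⟩)
    simp
  have hnear : ∀ z ∈ closure R, ∃ t, dist ((g k).1 (ray ξ hξ t) : E n) z < δ := by
    intro z hz
    have h1 : Metric.infEDist z S < ENNReal.ofReal δ := by
      refine lt_of_le_of_lt (Metric.infEDist_le_infEDist_add_hausdorffEDist (s := R)) ?_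
      rw [Metric.mem_closure_iff_infEDist_zero.1 hz, zero_add, Metric.hausdorffEDist_comm]
      exact hk₂
    obtain ⟨_, ⟨t, rfl⟩, ht⟩ := Metric.infEDist_lt_iff.1 h1
    refine ⟨t, ?_⟩
    rwa [edist_dist, ENNReal.ofReal_lt_ofReal_iff hδ0, dist_comm] at ht
  have hζ : bdMap (g k) ξ ∈ Metric.ball x δ ∪ Metric.ball y δ := by
    by_contra hno
    have h1 : Metric.infEDist (bdMap (g k) ξ) R < r := by
      refine lt_of_le_of_lt (Metric.infEDist_le_infEDist_add_hausdorffEDist (s := S)) ?_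
      rw [Metric.mem_closure_iff_infEDist_zero.1 hζS, zero_add]
      exact hk₁
    obtain ⟨w, hw, hlt⟩ := Metric.infEDist_lt_iff.1 h1
    exact absurd hlt (hsep _ ⟨by simpa using hζ1, hno⟩ _ (subset_closure hw)).le.not_gt
  have hxR : x ∈ closure R := mem_closure_of_tendsto (tendsto_lineMap_atBot x y)
    (Eventually.of_forall fun t => mem_range_self t)
  have hyR : y ∈ closure R := mem_closure_of_tendsto (tendsto_lineMap_atTop x y)
    (Eventually.of_forall fun t => mem_range_self t)
  refine ⟨g k, hg k, ?_⟩
  -- Hausdorff convergence ignores orientation, so the ray may end near either point; the element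
  -- chosen pushes towards that end.
  rcases hζ with hζ | hζ
  · obtain ⟨t, ht⟩ := hnear y hyR
    exact ⟨f⁻¹, Or.inr rfl, t, h₂ _ (lt_of_lt_of_le hζ (min_le_right _ _)) _
      (lt_of_lt_of_le ht (min_le_right _ _))⟩
  · obtain ⟨t, ht⟩ := hnear x hxR
    exact ⟨f, Or.inl rfl, t, h₁ _ (lt_of_lt_of_le hζ (min_le_left _ _)) _
      (lt_of_lt_of_le ht (min_le_left _ _))⟩

/-- The orbits of a normal subgroup which moves some limit point enter all horoballs at a Myrberg
point. -/
lemma exists_expBusemann_map_lt {G N : Subgroup (isomGroup n)} (hNG : N ≤ G)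
    (hN : (N.subgroupOf G).Normal) {ξ : E n} (hM : ξ ∈ myrbergLimitSet G) {f : isomGroup n}
    (hf : f ∈ N) {x : E n} (hx : x ∈ limitSet G) (hfx : bdMap f x ≠ x) (z : HypBall n)
    {ε : ℝ} (hε : 0 < ε) : ∃ h ∈ N, expBusemann ξ (h.1 z) < ε := by
  have hξ : ‖ξ‖ = 1 := by simpa using hM.1.1
  set c := coshDist z (ray ξ hξ 0) with hc
  have hc0 : 0 < c := lt_of_lt_of_le one_pos (one_le_coshDist _ _)
  -- Two uses of `expBusemann_le` cost `8 * 8 = 64`, and 65 makes the inequality strict; `c` pays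
  -- for passing from `z` to the start of the ray.
  obtain ⟨g, hg, e, he, t, hle⟩ := exists_expBusemann_map_ray_le hξ hM (hNG hf) hx hfx
    (show 0 < ε / (65 * c) by positivity)
  have heN : e ∈ N := by rcases he with rfl | rfl <;> simpa using hf
  have hhN : g⁻¹ * e * g ∈ N := by
    have := hN.conj_mem ⟨e, hNG heN⟩ (by simpa [Subgroup.mem_subgroupOf] using heN)
      ⟨g⁻¹, G.inv_mem hg⟩
    simpa [Subgroup.mem_subgroupOf] using this
  set h := g⁻¹ * e * g with hh
  refine ⟨h, hhN, ?_⟩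
  have hgh : ∀ p, g.1 (h.1 p) = e.1 (g.1 p) := by intro p; simp [hh]
  set q := ray ξ hξ t with hq
  have hlam := expBusemann_pos (norm_bdMap g hξ) (g.1 (origin n))
  have h1 : expBusemann ξ (h.1 q) ≤ ε / (65 * c) * expBusemann ξ q := by
    rw [← hgh, expBusemann_bdMap g hξ (h.1 q), expBusemann_bdMap g hξ q, mul_left_comm] at hle
    exact le_of_mul_le_mul_left hle hlam
  have h2 := expBusemann_le hξ (h.1 z) (h.1 (ray ξ hξ 0))
  have h3 := expBusemann_le hξ (h.1 (ray ξ hξ 0)) (h.1 q)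
  rw [coshDist_map] at h2 h3
  have h4 := coshDist_ray_mul_expBusemann_le hξ t
  set C := coshDist (ray ξ hξ 0) q with hC
  have hC0 : 0 ≤ C := coshDist_nonneg _ _
  calc expBusemann ξ (h.1 z)
      ≤ 8 * c * (8 * C * (ε / (65 * c) * expBusemann ξ q)) := by
        refine h2.trans ?_
        gcongr
        refine h3.trans ?_
        gcongr
    _ = 64 / 65 * ε * (C * expBusemann ξ q) := by field_simp; ring
    _ ≤ 64 / 65 * ε * 1 := by gcongr
    _ < ε := by linarith

/-! ### From Busemann functions to horospheric limit points. -/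

/-- The horoball is exactly the set where `expBusemann ξ` is below `r / (1 - r)`, which exceeds `r`.
-/
lemma mem_horoball_of_expBusemann_lt {ξ : E n} (hξ : ‖ξ‖ = 1) {r : ℝ} (hr0 : 0 < r) (hr1 : r < 1)
    {p : HypBall n} (h : expBusemann ξ p < r) : (p : E n) ∈ horoball ξ r := by
  have hp := one_sub_norm_sq_pos p
  unfold expBusemann at h
  rw [div_lt_iff₀ hp, norm_sub_sq_real, hξ] at h
  rw [horoball, mem_ball_iff_norm]
  refine lt_of_pow_lt_pow_left₀ 2 hr0.le ?_
  rw [norm_sub_sq_real, norm_smul, inner_smul_right, hξ, Real.norm_of_nonneg (by linarith),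
    real_inner_comm]
  nlinarith [sq_nonneg ‖ξ - p‖, norm_sub_sq_real ξ (p : E n)]

/-- A boundary point all of whose horoballs are entered by every orbit is a horospheric limit
point. -/
lemma mem_horosphericLimitSet {N : Subgroup (isomGroup n)} {ξ : E n} (hξ : ‖ξ‖ = 1)
    (h : ∀ z : HypBall n, ∀ ε > 0, ∃ h ∈ N, expBusemann ξ (h.1 z) < ε) :
    ξ ∈ horosphericLimitSet N := by
  refine ⟨⟨by simpa using hξ, fun z => ?_⟩, fun z r hr0 hr1 => ?_⟩
  · rw [accPt_iff_nhds]
    intro U hU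
    obtain ⟨ε, hε, hsub⟩ := Metric.mem_nhds_iff.1 hU
    obtain ⟨g, hg, hlt⟩ := h z (ε ^ 2) (by positivity)
    refine ⟨g.1 z, ⟨hsub ?_, g, hg, rfl⟩, (ne_coe_of_norm_eq_one hξ _).symm⟩
    rw [mem_ball_iff_norm, norm_sub_rev]
    have hp := one_sub_norm_sq_pos (g.1 z)
    unfold expBusemann at hlt
    rw [div_lt_iff₀ hp] at hlt
    refine lt_of_pow_lt_pow_left₀ 2 hε.le (hlt.trans_le ?_)
    nlinarith [sq_nonneg ‖(g.1 z : E n)‖, sq_nonneg ε]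
  · obtain ⟨g, hg, hlt⟩ := h z r hr0
    exact ⟨g.1 z, mem_horoball_of_expBusemann_lt hξ hr0 hr1 hlt, g, hg, rfl⟩

/-! ### Discrete groups fixing three boundary points are finite. -/

lemma one_sub_norm_sq_le_coshDist (p q : HypBall n) :
    1 - ‖(q : E n)‖ ^ 2 ≤ 2 * coshDist p q * (1 - ‖(p : E n)‖ ^ 2) := by
  have hp := one_sub_norm_sq_pos p
  have hq := one_sub_norm_sq_pos q
  have h := sq_one_sub_norm_sq_le p q
  have e : 2 * coshDist p q * (1 - ‖(p : E n)‖ ^ 2) = (2 * ((1 - ‖(p : E n)‖ ^ 2) *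
      (1 - ‖(q : E n)‖ ^ 2)) + 4 * ‖(p : E n) - q‖ ^ 2) / (1 - ‖(q : E n)‖ ^ 2) := by
    unfold coshDist
    field_simp
    ring
  rw [e, le_div_iff₀ hq]
  linarith

/-- An isometry fixing three boundary points preserves the horospheres at these points. -/
lemma expBusemann_map_origin_eq_one (f : isomGroup n) {a b c : E n} (ha : ‖a‖ = 1) (hb : ‖b‖ = 1)
    (hc : ‖c‖ = 1) (hab : a ≠ b) (hac : a ≠ c) (hbc : b ≠ c) (hfa : bdMap f a = a)
    (hfb : bdMap f b = b) (hfc : bdMap f c = c) : expBusemann a (f.1 (origin n)) = 1 := by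
  have key : ∀ {x y : E n}, ‖x‖ = 1 → ‖y‖ = 1 → x ≠ y → bdMap f x = x → bdMap f y = y →
      expBusemann x (f.1 (origin n)) * expBusemann y (f.1 (origin n)) = 1 := by
    intro x y hx hy hxy hfx hfy
    have h := norm_sq_bdMap_sub f hx hy
    rw [hfx, hfy] at h
    have h0 : ‖x - y‖ ^ 2 ≠ 0 := by simpa [sub_eq_zero] using hxy
    exact mul_right_cancel₀ h0 (by rw [one_mul]; exact h.symm)
  have h1 := key ha hb hab hfa hfb
  have h2 := key ha hc hac hfa hfc
  have h3 := key hb hc hbc hfb hfc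
  have hpos := expBusemann_pos ha (f.1 (origin n))
  set A := expBusemann a (f.1 (origin n))
  set B := expBusemann b (f.1 (origin n))
  set C := expBusemann c (f.1 (origin n))
  have h4 : A ^ 2 = 1 := by linear_combination h1 * A * C + h2 - A ^ 2 * h3
  nlinarith

/-- A set of isometries moving the origin by a bounded amount moves every point by a bounded
amount. -/
lemma exists_pos_le_one_sub_norm_sq {N : Set (isomGroup n)} {η : ℝ} (hη : 0 < η)
    (h : ∀ f ∈ N, η ≤ 1 - ‖(f.1 (origin n) : E n)‖ ^ 2) (x : HypBall n) :
    ∃ κ > 0, ∀ f ∈ N, κ ≤ 1 - ‖(f.1 x : E n)‖ ^ 2 := by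
  have hC : 0 < coshDist x (origin n) := lt_of_lt_of_le one_pos (one_le_coshDist _ _)
  refine ⟨η / (2 * coshDist x (origin n)), by positivity, fun f hf => ?_⟩
  have h1 := one_sub_norm_sq_le_coshDist (f.1 x) (f.1 (origin n))
  rw [coshDist_map] at h1
  rw [div_le_iff₀ (by positivity)]
  linarith [h f hf]

/-- `f` carries `f⁻¹ g x` and `x` to `g x` and `f x`. As these stay away from the sphere, their
closeness pulls back: `f⁻¹ g` almost fixes `x`. -/
lemma norm_sq_inv_mul_sub_le (f g : isomGroup n) (x : HypBall n) {κ : ℝ} (hκ : 0 < κ)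
    (hf : κ ≤ 1 - ‖(f.1 x : E n)‖ ^ 2) (hg : κ ≤ 1 - ‖(g.1 x : E n)‖ ^ 2) :
    ‖((f⁻¹ * g).1 x : E n) - x‖ ^ 2 ≤ ‖(g.1 x : E n) - f.1 x‖ ^ 2 / κ ^ 2 := by
  have e : f.1 ((f⁻¹ * g).1 x) = g.1 x := by simp
  have h := norm_sq_map_sub f ((f⁻¹ * g).1 x) x
  rw [e] at h
  set y := (f⁻¹ * g).1 x
  have h1 := one_sub_norm_sq_pos x
  have h2 := one_sub_norm_sq_pos y
  have h3 : (1 - ‖(y : E n)‖ ^ 2) * (1 - ‖(x : E n)‖ ^ 2) ≤ 1 :=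
    mul_le_one₀ (by nlinarith [sq_nonneg ‖(y : E n)‖]) h1.le (by nlinarith [sq_nonneg ‖(x : E n)‖])
  have h4 : κ ^ 2 ≤ (1 - ‖(g.1 x : E n)‖ ^ 2) * (1 - ‖(f.1 x : E n)‖ ^ 2) := by
    rw [sq]; exact mul_le_mul hg hf hκ.le (hκ.le.trans hg)
  rw [le_div_iff₀ (by positivity)]
  calc ‖(y : E n) - x‖ ^ 2 * κ ^ 2
      ≤ ‖(y : E n) - x‖ ^ 2 * ((1 - ‖(g.1 x : E n)‖ ^ 2) * (1 - ‖(f.1 x : E n)‖ ^ 2)) := by gcongr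
    _ = ‖(g.1 x : E n) - f.1 x‖ ^ 2 * ((1 - ‖(y : E n)‖ ^ 2) * (1 - ‖(x : E n)‖ ^ 2)) := h.symm
    _ ≤ ‖(g.1 x : E n) - f.1 x‖ ^ 2 * 1 := by gcongr
    _ = _ := mul_one _

lemma tendsto_nhds_one_iff {ι : Type*} {l : Filter ι} {u : ι → isomGroup n} :
    Tendsto u l (𝓝 1) ↔ ∀ x : HypBall n, Tendsto (fun i => ((u i).1 x : E n)) l (𝓝 (x : E n)) := by
  rw [nhds_induced, tendsto_comap_iff, tendsto_pi_nhds]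
  exact forall_congr' fun x => tendsto_subtype_rng

/-- A subgroup of a discrete group which moves the origin by a bounded amount is finite. -/
lemma finite_of_bounded {G N : Subgroup (isomGroup n)} [DiscreteTopology G] (hNG : N ≤ G)
    {η : ℝ} (hη : 0 < η) (h : ∀ f ∈ N, η ≤ 1 - ‖(f.1 (origin n) : E n)‖ ^ 2) : Finite N := by
  by_contra hfin
  have hinf : Infinite N := not_finite_iff_infinite.1 hfin
  -- Along a nonprincipal ultrafilter all orbit maps converge at once, so `f⁻¹ g` tends to 1 along
  -- its square, and discreteness makes it eventually 1.
  let U : Ultrafilter N := hyperfilter N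
  let L : Filter (N × N) := (U : Filter N) ×ˢ (U : Filter N)
  have hconv : ∀ x : HypBall n, Tendsto
      (fun v : N × N => (((v.1 : isomGroup n)⁻¹ * v.2).1 x : E n)) L (𝓝 (x : E n)) := by
    intro x
    obtain ⟨κ, hκ, hκN⟩ := exists_pos_le_one_sub_norm_sq (N := (N : Set (isomGroup n))) hη h x
    obtain ⟨φ, -, hφ⟩ := (isCompact_closedBall (0 : E n) 1).ultrafilter_le_nhds
      (U.map fun f : N => (f.1.1 x : E n)) (by
        refine le_principal_iff.2 (Ultrafilter.mem_map.2 (univ_mem' fun f => ?_))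
        simpa using (norm_lt_one (f.1.1 x)).le)
    have hφ' : Tendsto (fun f : N => (f.1.1 x : E n)) U (𝓝 φ) := hφ
    have hsub : Tendsto (fun v : N × N => ‖(v.2.1.1 x : E n) - v.1.1.1 x‖ ^ 2 / κ ^ 2) L (𝓝 0) := by
      have := ((((hφ'.comp tendsto_snd).sub (hφ'.comp tendsto_fst)).norm.pow 2).div_const
        (κ ^ 2) : Tendsto _ L _)
      simpa using this
    have hsq := squeeze_zero (fun _ => sq_nonneg _)
      (fun v : N × N => norm_sq_inv_mul_sub_le v.1.1 v.2.1 x hκ (hκN _ v.1.2) (hκN _ v.2.2)) hsub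
    rw [tendsto_iff_norm_sub_tendsto_zero]
    have := hsq.sqrt
    simpa using this
  have hone : Tendsto (fun v : N × N => (⟨(v.1 : isomGroup n)⁻¹ * v.2,
      G.mul_mem (G.inv_mem (hNG v.1.2)) (hNG v.2.2)⟩ : G)) L (𝓝 1) := by
    rw [tendsto_subtype_rng]
    exact tendsto_nhds_one_iff.2 hconv
  rw [nhds_discrete, tendsto_pure] at hone
  obtain ⟨f, hf⟩ := hone.curry.exists
  refine (finite_singleton f).notMem_hyperfilter ?_
  filter_upwards [hf] with g hg
  have hg' : (f : isomGroup n)⁻¹ * g = 1 := congrArg Subtype.val hg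
  exact Subtype.ext (inv_mul_eq_one.1 hg').symm

/-- A subgroup of a discrete group which fixes three boundary points is finite. -/
lemma finite_of_fixes_three {G N : Subgroup (isomGroup n)} [DiscreteTopology G] (hNG : N ≤ G)
    {a b c : E n} (ha : ‖a‖ = 1) (hb : ‖b‖ = 1) (hc : ‖c‖ = 1) (hab : a ≠ b) (hac : a ≠ c)
    (hbc : b ≠ c) (hfix : ∀ f ∈ N, bdMap f a = a ∧ bdMap f b = b ∧ bdMap f c = c) :
    Finite N := by
  have h0 : 0 < ‖a - b‖ := norm_pos_iff.2 (sub_ne_zero.2 hab)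
  -- Both `a` and `b` lie at squared distance `1 - |f 0|²` from `f 0`; the triangle inequality gives
  -- the bound.
  refine finite_of_bounded hNG (show 0 < ‖a - b‖ ^ 2 / 4 by positivity) fun f hf => ?_
  obtain ⟨hfa, hfb, hfc⟩ := hfix f hf
  have h1 := expBusemann_map_origin_eq_one f ha hb hc hab hac hbc hfa hfb hfc
  have h2 := expBusemann_map_origin_eq_one f hb ha hc hab.symm hbc hac hfb hfa hfc
  have hp := one_sub_norm_sq_pos (f.1 (origin n))
  unfold expBusemann at h1 h2
  rw [div_eq_one_iff_eq hp.ne'] at h1 h2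
  have h3 : ‖a - b‖ ≤ ‖a - f.1 (origin n)‖ + ‖b - f.1 (origin n)‖ := by
    rw [norm_sub_rev b]
    exact norm_sub_le_norm_sub_add_norm_sub _ _ _
  nlinarith [sq_nonneg (‖a - f.1 (origin n)‖ - ‖b - f.1 (origin n)‖)]

/-! ### Hyperboloid coordinates and reflections. -/

/-- The time coordinate of a point in the hyperboloid model. -/
def timeCoord (p : HypBall n) : ℝ := (1 + ‖(p : E n)‖ ^ 2) / (1 - ‖(p : E n)‖ ^ 2)

/-- The space coordinate of a point in the hyperboloid model. -/
def spaceCoord (p : HypBall n) : E n := (2 / (1 - ‖(p : E n)‖ ^ 2)) • (p : E n)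

lemma timeCoord_pos (p : HypBall n) : 0 < timeCoord p := by
  have := one_sub_norm_sq_pos p
  unfold timeCoord
  positivity

lemma timeCoord_sq (p : HypBall n) : timeCoord p ^ 2 = 1 + ‖spaceCoord p‖ ^ 2 := by
  have := one_sub_norm_sq_pos p
  unfold timeCoord spaceCoord
  rw [norm_smul, Real.norm_of_nonneg (by positivity)]
  field_simp
  ring

lemma one_add_timeCoord (p : HypBall n) :
    1 + timeCoord p = 2 / (1 - ‖(p : E n)‖ ^ 2) := by
  have := one_sub_norm_sq_pos p
  unfold timeCoord
  field_simp
  ring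

lemma spaceCoord_eq (p : HypBall n) : spaceCoord p = (1 + timeCoord p) • (p : E n) := by
  rw [one_add_timeCoord, spaceCoord]

lemma spaceCoord_injective : Function.Injective (spaceCoord (n := n)) := by
  intro p q h
  have h1 : timeCoord p = timeCoord q := by
    have := timeCoord_sq p
    rw [h, ← timeCoord_sq] at this
    exact (pow_left_inj₀ (timeCoord_pos p).le (timeCoord_pos q).le two_ne_zero).1 this
  rw [spaceCoord_eq, spaceCoord_eq, h1] at h
  exact Subtype.ext (smul_right_injective _ (by linarith [timeCoord_pos q] : 1 + timeCoord q ≠ 0) h)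

lemma coshDist_eq (p q : HypBall n) :
    coshDist p q = timeCoord p * timeCoord q - inner ℝ (spaceCoord p) (spaceCoord q) := by
  have hp := one_sub_norm_sq_pos p
  have hq := one_sub_norm_sq_pos q
  unfold coshDist timeCoord spaceCoord
  rw [norm_sub_sq_real, inner_smul_left, inner_smul_right, RCLike.conj_to_real]
  field_simp
  ring

/-- This is the Lorentz pairing with the null vector `(1, a)`, so preserving horospheres at `a`
becomes a linear condition. -/
lemma expBusemann_eq {a : E n} (ha : ‖a‖ = 1) (p : HypBall n) :
    expBusemann a p = timeCoord p - inner ℝ a (spaceCoord p) := by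
  have hp := one_sub_norm_sq_pos p
  unfold expBusemann timeCoord spaceCoord
  rw [norm_sub_sq_real, inner_smul_right, ha]
  field_simp
  ring

/-- Three points of a sphere are not collinear. -/
lemma linearIndependent_sub_of_norm_eq_one {a b c : E n} (ha : ‖a‖ = 1) (hb : ‖b‖ = 1)
    (hc : ‖c‖ = 1) (hab : a ≠ b) (hac : a ≠ c) (hbc : b ≠ c) :
    LinearIndependent ℝ ![a - b, a - c] := by
  have hlt : ∀ {x y : E n}, ‖x‖ = 1 → ‖y‖ = 1 → x ≠ y → 0 < 1 - inner ℝ x y := by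
    intro x y hx hy hxy
    have h0 : 0 < ‖x - y‖ := norm_pos_iff.2 (sub_ne_zero.2 hxy)
    rw [inner_eq_one_sub hx hy]
    have := pow_pos h0 2
    linarith
  have hA := hlt ha hb hab
  have hB := hlt ha hc hac
  have hD := hlt hb hc hbc
  rw [LinearIndependent.pair_iff]
  intro s t hst
  have key : ∀ x : E n, s * (inner ℝ x a - inner ℝ x b) + t * (inner ℝ x a - inner ℝ x c) = 0 := by
    intro x
    have := congrArg (inner ℝ x) hst
    simpa [inner_add_right, inner_smul_right, inner_sub_right] using this
  have h1 := key a
  have h2 := key b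
  have h3 := key c
  rw [real_inner_self_eq_norm_sq, ha] at h1
  rw [real_inner_self_eq_norm_sq, hb, real_inner_comm a b] at h2
  rw [real_inner_self_eq_norm_sq, hc, real_inner_comm a c, real_inner_comm b c] at h3
  set A := inner ℝ a b
  set B := inner ℝ a c
  set D := inner ℝ b c
  have ht : t = 0 := by
    by_contra ht
    have e1 : A - B + (1 - D) = 0 := by
      refine (mul_eq_zero.1 (?_ : t * _ = 0)).resolve_left ht
      linear_combination h1 + h2
    have hs : s = 0 := by
      refine (mul_eq_zero.1 (?_ : s * (1 - D) = 0)).resolve_right hD.ne'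
      linear_combination (h1 + h3) / 2 + s / 2 * e1
    rw [hs] at h1
    refine ht ((mul_eq_zero.1 (?_ : t * (1 - B) = 0)).resolve_right hB.ne')
    linear_combination h1
  refine ⟨?_, ht⟩
  rw [ht] at h1
  refine (mul_eq_zero.1 (?_ : s * (1 - A) = 0)).resolve_right hA.ne'
  linear_combination h1

/-- The complement of a plane in dimension `n + 1 ≤ 3` is at most a line. -/
lemma exists_forall_orthogonal_eq_smul (hn : n ≤ 2) {v w : E n}
    (h : LinearIndependent ℝ ![v, w]) :
    ∃ u : E n, inner ℝ v u = 0 ∧ inner ℝ w u = 0 ∧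
      ∀ z : E n, inner ℝ v z = 0 → inner ℝ w z = 0 → ∃ r : ℝ, z = r • u := by
  set S := Submodule.span ℝ (range ![v, w]) with hS
  have hmem : ∀ z : E n, z ∈ Sᗮ ↔ inner ℝ v z = 0 ∧ inner ℝ w z = 0 := by
    intro z
    rw [hS, Submodule.mem_orthogonal]
    constructor
    · intro hz
      exact ⟨hz v (Submodule.subset_span ⟨0, rfl⟩), hz w (Submodule.subset_span ⟨1, rfl⟩)⟩
    · rintro ⟨h1, h2⟩ y hy
      induction hy using Submodule.span_induction with
      | mem x hx =>
        obtain ⟨i, rfl⟩ := hx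
        fin_cases i
        · exact h1
        · exact h2
      | zero => simp
      | add x y _ _ hx hy => rw [inner_add_left, hx, hy, add_zero]
      | smul r x _ hx => rw [inner_smul_left, hx, mul_zero]
  have hS2 : Module.finrank ℝ S = 2 := by simpa using finrank_span_eq_card h
  have hsum := Submodule.finrank_add_finrank_orthogonal S
  rw [hS2, finrank_euclideanSpace_fin] at hsum
  obtain ⟨u, hu⟩ := finrank_le_one_iff.1 (show Module.finrank ℝ Sᗮ ≤ 1 by omega)
  have hu' := (hmem u).1 u.2
  refine ⟨u, hu'.1, hu'.2, fun z h1 h2 => ?_⟩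
  obtain ⟨r, hr⟩ := hu ⟨z, (hmem z).2 ⟨h1, h2⟩⟩
  exact ⟨r, by rw [← Submodule.coe_smul, hr]⟩

/-- An isometry which moves the points of the hyperboloid model in the spacelike direction `(s, u)`
only, and is not the identity, is the reflection in the orthogonal hyperplane. -/
lemma shift_eq_of_ne_one {f : isomGroup n} {u : E n} (hu : ‖u‖ = 1) {s : ℝ} {τ : HypBall n → ℝ}
    (hV : ∀ p, spaceCoord (f.1 p) = spaceCoord p + τ p • u)
    (hT : ∀ p, timeCoord (f.1 p) = timeCoord p + τ p * s) (hf : f ≠ 1) (p : HypBall n) :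
    τ p * (1 - s ^ 2) = 2 * (s * timeCoord p - inner ℝ (spaceCoord p) u) := by
  obtain ⟨x, hx⟩ : ∃ x, τ x ≠ 0 := by
    by_contra! h0
    refine hf (Subtype.ext (Equiv.ext fun x => spaceCoord_injective ?_))
    rw [hV, h0, zero_smul, add_zero]
    rfl
  have h1 : τ x * (1 - s ^ 2) = 2 * (s * timeCoord x - inner ℝ (spaceCoord x) u) := by
    have e := timeCoord_sq (f.1 x)
    rw [hV, hT, norm_add_sq_real, norm_smul, hu, inner_smul_right, mul_one, Real.norm_eq_abs,
      sq_abs] at e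
    refine mul_left_cancel₀ hx ?_
    linear_combination timeCoord_sq x - e
  -- The hyperboloid equation gives the formula only where `τ ≠ 0`; invariance of the pairing with
  -- such an `x` spreads it to all `p`.
  have h2 := coshDist_map f p x
  rw [coshDist_eq, coshDist_eq, hV, hV, hT, hT, inner_add_left, inner_add_right, inner_add_right,
    inner_smul_left, inner_smul_left, inner_smul_right, inner_smul_right,
    real_inner_self_eq_norm_sq, hu, RCLike.conj_to_real, real_inner_comm (spaceCoord x) u] at h2
  refine mul_left_cancel₀ hx ?_
  linear_combination (-2) * h2 - τ p * h1


/-- A nontrivial isometry moving points in a spacelike direction only is orientation reversing. -/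
lemma not_isOrientationPreserving_of_shift {f : isomGroup n} {u : E n} (hu : ‖u‖ = 1) {s : ℝ}
    (hs : s ^ 2 < 1) {τ : HypBall n → ℝ}
    (hV : ∀ p, spaceCoord (f.1 p) = spaceCoord p + τ p • u)
    (hT : ∀ p, timeCoord (f.1 p) = timeCoord p + τ p * s) (hf : f ≠ 1) :
    ¬ IsOrientationPreserving f := by
  intro hor
  -- Up to the factor `1 - |p|²`, `k` is the Lorentz pairing with `(s, u)`; its zero set is the
  -- mirror.
  set k : E n → ℝ := fun p => s * (1 + ‖p‖ ^ 2) - 2 * inner ℝ u p with hk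
  have hs0 : 0 < 1 - s ^ 2 := by linarith
  have hform : ∀ p : HypBall n,
      (f.1 p : E n) = p + (k p / (1 - s ^ 2 + s * k p)) • (u - s • (p : E n)) := by
    intro p
    have hw := one_sub_norm_sq_pos p
    have hTf := timeCoord_pos (f.1 p)
    have hτ := shift_eq_of_ne_one hu hV hT hf p
    have hτk : τ p = 2 * k p / ((1 - s ^ 2) * (1 - ‖(p : E n)‖ ^ 2)) := by
      have hin : inner ℝ (spaceCoord p) u = 2 / (1 - ‖(p : E n)‖ ^ 2) * inner ℝ u (p : E n) := by
        rw [real_inner_comm, spaceCoord, inner_smul_right]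
      rw [eq_div_iff (by positivity), ← mul_assoc, hτ, hin, timeCoord, hk]
      field_simp
    have hden : 1 + timeCoord (f.1 p) =
        2 * (1 - s ^ 2 + s * k p) / ((1 - s ^ 2) * (1 - ‖(p : E n)‖ ^ 2)) := by
      rw [hT, ← add_assoc, one_add_timeCoord, hτk]
      field_simp
    have hden0 : 1 - s ^ 2 + s * k p ≠ 0 := by
      intro h0
      rw [h0, mul_zero, zero_div] at hden
      linarith
    have hψ : k p / (1 - s ^ 2 + s * k p) = τ p / (1 + timeCoord (f.1 p)) := by
      rw [hden, hτk]
      field_simp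
    have hne : 1 + timeCoord (f.1 p) ≠ 0 := by linarith
    have h1 : (1 + timeCoord (f.1 p)) • (f.1 p : E n) =
        (1 + timeCoord (f.1 p)) • (p : E n) + τ p • (u - s • (p : E n)) := by
      rw [← spaceCoord_eq, hV, spaceCoord_eq, hT]
      module
    rw [hψ]
    refine smul_right_injective _ hne ?_
    simp only [h1, smul_add, smul_smul, mul_div_cancel₀ _ hne]
  -- the point of the mirror on the line spanned by `u`
  set c := √(1 - s ^ 2) with hc
  have hc0 : 0 < c := Real.sqrt_pos.2 hs0
  have hc2 : c ^ 2 = 1 - s ^ 2 := Real.sq_sqrt hs0.le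
  -- The root of `s (1 + t²) = 2t` inside the unit interval, in a form valid also for `s = 0`.
  obtain ⟨t, ht⟩ : ∃ t, t * (1 + c) = s := ⟨s / (1 + c), by field_simp⟩
  have hst : 1 - s * t = c := by
    have h1 : 1 + c ≠ 0 := by positivity
    refine mul_right_cancel₀ h1 ?_
    linear_combination -s * ht - hc2
  have hst2 : s * (1 + t ^ 2) = 2 * t := by linear_combination -t * hst - ht
  have ht2 : ‖t • u‖ ^ 2 = t ^ 2 := by rw [norm_smul, hu, mul_one, Real.norm_eq_abs, sq_abs]
  have hmem : t • u ∈ Metric.ball (0 : E n) 1 := by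
    rw [mem_ball_zero_iff]
    have h1 : t ^ 2 < 1 := by nlinarith [sq_nonneg t]
    nlinarith [norm_nonneg (t • u)]
  have hk0 : k (t • u) = 0 := by
    simp only [hk, ht2, inner_smul_right, real_inner_self_eq_norm_sq, hu]
    linear_combination hst2
  have hkd : HasFDerivAt k ((-2 * c) • innerSL ℝ u) (t • u) := by
    have h1 : HasFDerivAt k (s • (2 • (innerSL ℝ (t • u))) - (2 : ℝ) • innerSL ℝ u) (t • u) := by
      have e1 := ((hasStrictFDerivAt_norm_sq (t • u)).hasFDerivAt.const_add 1).const_mul s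
      have e2 := ((innerSL ℝ u).hasFDerivAt (x := t • u)).const_mul (2 : ℝ)
      exact e1.sub e2
    refine h1.congr_fderiv (ContinuousLinearMap.ext fun v => ?_)
    simp
    linear_combination -2 * inner ℝ u v * hst
  have hψd : HasFDerivAt (fun p => k p / (1 - s ^ 2 + s * k p))
      ((1 - s ^ 2)⁻¹ • (-2 * c) • innerSL ℝ u) (t • u) := by
    have h1 : HasDerivAt (fun r : ℝ => r / (1 - s ^ 2 + s * r)) (1 - s ^ 2)⁻¹ (k (t • u)) := by
      rw [hk0]
      have e1 : HasDerivAt (fun r : ℝ => 1 - s ^ 2 + s * r) (s * 1) 0 :=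
        ((hasDerivAt_id (0 : ℝ)).const_mul s).const_add _
      have e2 := (hasDerivAt_id' (0 : ℝ)).fun_div e1 (by simpa using hs0.ne')
      refine e2.congr_deriv ?_
      simp only [mul_zero, add_zero, zero_mul, sub_zero, one_mul]
      field_simp
    exact h1.comp_hasFDerivAt (t • u) hkd
  have hmain : HasFDerivAt (extendMap f) (ContinuousLinearMap.id ℝ (E n) +
      ((-2 : ℝ) • innerSL ℝ u).smulRight u) (t • u) := by
    have h1 : HasFDerivAt (fun p : E n => p + (k p / (1 - s ^ 2 + s * k p)) • (u - s • p)) _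
        (t • u) :=
      (hasFDerivAt_id (t • u)).add (hψd.smul
        (((hasFDerivAt_id (t • u)).const_smul s).const_sub u))
    have h2 := h1.congr_of_eventuallyEq (f₁ := extendMap f) (by
      filter_upwards [Metric.isOpen_ball.mem_nhds hmem] with p hp
      rw [← hform ⟨p, hp⟩]
      exact dif_pos hp)
    -- As `k` vanishes here, only its derivative contributes: `-2c / (1 - s²)` times `c` is `-2`, a
    -- Euclidean reflection.
    have e : u - s • t • u = c • u := by rw [smul_smul, ← hst, sub_smul, one_smul]
    rw [hk0, zero_div, zero_smul, zero_add, e] at h2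
    refine h2.congr_fderiv (ContinuousLinearMap.ext fun v => ?_)
    simp [smul_smul]
    congr 1
    field_simp
    linear_combination (inner ℝ u v) * hc2
  have hdet := hor _ hmem
  rw [hmain.fderiv] at hdet
  have hdet' : (ContinuousLinearMap.id ℝ (E n) +
      ((-2 : ℝ) • innerSL ℝ u).smulRight u).det = -1 := by
    have e : ((ContinuousLinearMap.id ℝ (E n) + ((-2 : ℝ) • innerSL ℝ u).smulRight u :
        E n →L[ℝ] E n) : E n →ₗ[ℝ] E n) =
        LinearMap.transvection (((-2 : ℝ) • innerSL ℝ u : E n →L[ℝ] ℝ) : E n →ₗ[ℝ] ℝ) u := by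
      ext1 v
      simp [LinearMap.transvection.apply]
    rw [ContinuousLinearMap.det, e, LinearMap.transvection.det]
    simp [hu]
    norm_num
  rw [hdet'] at hdet
  linarith

/-- In dimension at most three, an orientation preserving isometry fixing three boundary points is
the identity. -/
lemma eq_one_of_fixes_three (hn : n ≤ 2) {f : isomGroup n} (hor : IsOrientationPreserving f)
    {a b c : E n} (ha : ‖a‖ = 1) (hb : ‖b‖ = 1) (hc : ‖c‖ = 1) (hab : a ≠ b) (hac : a ≠ c)
    (hbc : b ≠ c) (hfa : bdMap f a = a) (hfb : bdMap f b = b) (hfc : bdMap f c = c) : f = 1 := by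
  -- Preserved horospheres make each hyperboloid displacement Lorentz-orthogonal to `(1, x)` for `x
  -- = a, b, c`.
  have key : ∀ {x : E n}, ‖x‖ = 1 → bdMap f x = x → expBusemann x (f.1 (origin n)) = 1 →
      ∀ p, timeCoord (f.1 p) - timeCoord p = inner ℝ x (spaceCoord (f.1 p) - spaceCoord p) := by
    intro x hx hfx h1 p
    have h := expBusemann_bdMap f hx p
    rw [hfx, h1, one_mul, expBusemann_eq hx, expBusemann_eq hx] at h
    rw [inner_sub_right]
    linarith
  have ka := key ha hfa (expBusemann_map_origin_eq_one f ha hb hc hab hac hbc hfa hfb hfc)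
  have kb := key hb hfb (expBusemann_map_origin_eq_one f hb ha hc hab.symm hbc hac hfb hfa hfc)
  have kc := key hc hfc (expBusemann_map_origin_eq_one f hc ha hb hac.symm hbc.symm hab hfc hfa hfb)
  obtain ⟨v, hv1, hv2, hv⟩ := exists_forall_orthogonal_eq_smul hn
    (linearIndependent_sub_of_norm_eq_one ha hb hc hab hac hbc)
  have hshift : ∀ p, ∃ r : ℝ, spaceCoord (f.1 p) - spaceCoord p = r • v := by
    intro p
    refine hv _ ?_ ?_
    · rw [inner_sub_left, ← ka, ← kb, sub_self]
    · rw [inner_sub_left, ← ka, ← kc, sub_self]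
  by_contra hf
  have hv0 : v ≠ 0 := by
    rintro rfl
    refine hf (Subtype.ext (Equiv.ext fun x => spaceCoord_injective ?_))
    obtain ⟨r, hr⟩ := hshift x
    rw [smul_zero, sub_eq_zero] at hr
    exact hr
  have hvn : 0 < ‖v‖ := norm_pos_iff.2 hv0
  set u := ‖v‖⁻¹ • v with hu
  have hu1 : ‖u‖ = 1 := norm_smul_inv_norm hv0
  have hvu : v = ‖v‖ • u := by rw [hu, smul_smul, mul_inv_cancel₀ hvn.ne', one_smul]
  choose r hr using hshift
  have hr' : ∀ p, spaceCoord (f.1 p) - spaceCoord p = (r p * ‖v‖) • u := by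
    intro p
    rw [hr, mul_smul, ← hvu]
  have hbu : inner ℝ b u = inner ℝ a u := by
    rw [inner_sub_left] at hv1
    rw [hu, inner_smul_right, inner_smul_right, sub_eq_zero.1 hv1]
  clear_value u
  refine not_isOrientationPreserving_of_shift hu1 (s := inner ℝ a u) (τ := fun p => r p * ‖v‖)
    ?_ (fun p => ?_) (fun p => ?_) hf hor
  -- Otherwise equality in Cauchy–Schwarz would force both `a` and `b` to be the same multiple of
  -- `u`.
  · by_contra! hs
    have hdist : ∀ {x : E n}, ‖x‖ = 1 → inner ℝ x u = inner ℝ a u → x = (inner ℝ a u : ℝ) • u := by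
      intro x hx hxu
      rw [← sub_eq_zero, ← norm_eq_zero, ← sq_eq_zero_iff]
      have h1 := norm_sub_sq_real x ((inner ℝ a u : ℝ) • u)
      rw [inner_smul_right, hxu, norm_smul, hu1, hx, mul_one, Real.norm_eq_abs, sq_abs] at h1
      nlinarith [sq_nonneg ‖x - (inner ℝ a u : ℝ) • u‖]
    exact hab ((hdist ha rfl).trans (hdist hb hbu).symm)
  · rw [← hr']; abel
  · have h := ka p
    rw [hr', inner_smul_right] at h
    linarith

/-- Under the assumptions of the theorem, `N` does not fix the limit set of `G` pointwise. -/
lemma exists_bdMap_ne {n : ℕ} {G N : Subgroup (isomGroup n)} (hG : IsKleinian G)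
    (hGne : IsNonElementary G) (hNG : N ≤ G) (hNnontrivial : N ≠ ⊥)
    (hNinfinite : 3 ≤ n → Infinite N) : ∃ f ∈ N, ∃ x ∈ limitSet G, bdMap f x ≠ x := by
  by_contra! h
  have h3 : (3 : ℕ∞) ≤ (limitSet G).encard := by
    have := Order.add_one_le_of_lt (show (2 : ℕ∞) < (limitSet G).encard from hGne)
    rwa [two_add_one_eq_three] at this
  obtain ⟨t, htL, ht⟩ := exists_subset_encard_eq h3
  obtain ⟨a, b, c, hab, hac, hbc, rfl⟩ := encard_eq_three.1 ht
  have ha : a ∈ limitSet G := htL (by simp)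
  have hb : b ∈ limitSet G := htL (by simp)
  have hc : c ∈ limitSet G := htL (by simp)
  have hnorm : ∀ {x : E n}, x ∈ limitSet G → ‖x‖ = 1 := fun hx => by simpa using hx.1
  rcases le_or_gt 3 n with hn | hn
  · have := hNinfinite hn
    have := hG.discrete
    exact not_finite_iff_infinite.2 ‹Infinite N› (finite_of_fixes_three hNG (hnorm ha) (hnorm hb)
      (hnorm hc) hab hac hbc fun f hf => ⟨h f hf a ha, h f hf b hb, h f hf c hc⟩)
  · refine hNnontrivial ((Subgroup.eq_bot_iff_forall N).2 fun f hf => ?_)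
    exact eq_one_of_fixes_three (by omega) (hG.orientationPreserving f (hNG hf)) (hnorm ha)
      (hnorm hb) (hnorm hc) hab hac hbc (h f hf a ha) (h f hf b hb) (h f hf c hc)

end

end Kleinian

theorem mainTheorem1 (n : ℕ) (hn : 1 ≤ n)
    (G N : Subgroup (Kleinian.isomGroup n))
    (hG : Kleinian.IsKleinian G) (hGne : Kleinian.IsNonElementary G)
    (hNG : N ≤ G) (hNnormal : (N.subgroupOf G).Normal)
    (hNnontrivial : N ≠ ⊥)
    (hNinfinite : 3 ≤ n → Infinite N) :
    Kleinian.myrbergLimitSet G ⊆ Kleinian.horosphericLimitSet N := by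
  intro ξ hξ
  obtain ⟨f, hf, x, hx, hfx⟩ := Kleinian.exists_bdMap_ne hG hGne hNG hNnontrivial hNinfinite
  exact Kleinian.mem_horosphericLimitSet (by simpa using hξ.1.1) fun z ε hε =>
    Kleinian.exists_expBusemann_map_lt hNG hNnormal hξ hf hx hfx z hε
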